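/- Let $\mathcal A=\{H_1,\dots,H_l\}$ be an arrangement of pairwise distinct hyperplanes in $\mathbb{CP}^n$; identify projective subspaces with their cones, which are linear subspaces of $\mathbb C^{n+1}$, so that a hyperplane has linear dimension $n$ and the zero subspace represents $\emptyset$. Let $E$ be the exterior algebra of $\mathbb C^l$ with canonical generators $x_1,\dots,x_l$, let $K\subseteq E$ be the two-sided ideal generated by the elements $$\partial(x_{i_1}\wedge\cdots\wedge x_{i_m})=\sum_{j=1}^m(-1)^j\,x_{i_1}\wedge\cdots\wedge x_{i_{j-1}}\wedge x_{i_{j+1}}\wedge\cdots\wedge x_{i_m}$$ for distinct $i_1,\dots,i_m$ such that $H_{i_1}\cap\cdots\cap H_{i_m}$ is nonempty and of codimension less than $m$, and by the monomials $x_{i_1}\wedge\cdots\wedge x_{i_m}$ for distinct $i_1,\dots,i_m$ with $H_{i_1}\cap\cdots\cap H_{i_m}=\emptyset$. Let $A=E/K$ be the Orlik–Solomon algebra and $A^1\subseteq A$ its degree-one part, spanned by $x_1,\dots,x_l$. For an integer $k\ge 0$, a linear subspace $V\subseteq A^1$ is called $k$-isotropic if the product of any $k$ vectors of $V$ is zero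 in $A$. Let $V\subseteq A^1$ be a linear subspace and let $M$ be an $r\times l$ complex matrix whose rows are the coefficients with respect to $x_1,\dots,x_l$ of a generating system of $V$. Let $v_1,\dots,v_l\in\mathbb C^r$ be the columns of $M$, and decorate every flat $S$ (nonempty intersection of hyperplanes of $\mathcal A$) with the vector $v_S=\sum_{H_i\supseteq S}v_i$. Then $V$ is $k$-isotropic if and only if for every truncated flag of flats $S_k\supset\cdots\supset S_1$ whose linear dimensions (dimensions of the cones in $\mathbb C^{n+1}$) are $\dim S_i=i+n-k$, the vectors $v_{S_k},\dots,v_{S_1}$ span a space of dimension less than $k$. -/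

import Mathlib

/-- An arrangement of `l` pairwise distinct hyperplanes `H_1, …, H_l` in the projective space
`ℂP^n`. A projective subspace is given by its cone, a linear subspace of `ℂ^(n+1)`; so a
hyperplane is a linear subspace of dimension `n`, and the zero subspace is the empty set. -/
structure ProjArrangement (n l : ℕ) where
  hyp : Fin l → Submodule ℂ (Fin (n + 1) → ℂ)
  finrank_hyp : ∀ i, Module.finrank ℂ (hyp i) = n
  hyp_injective : Function.Injective hyp

namespace ProjArrangement

/-- The exterior algebra `E` of `ℂ^l`. -/
abbrev Ext (l : ℕ) : Type := ExteriorAlgebra ℂ (Fin l → ℂ)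

/-- The monomial `x_{t 1} ∧ ⋯ ∧ x_{t m}` in the canonical generators of `E`. -/
noncomputable def monomial {l m : ℕ} (t : Fin m → Fin l) : Ext l :=
  ExteriorAlgebra.ιMulti ℂ m (fun j => (Pi.single (t j) 1 : Fin l → ℂ))

/-- `∂(x_{t 1} ∧ ⋯ ∧ x_{t m}) = ∑_j (-1)^j x_{t 1} ∧ ⋯ (omit the factor j) ⋯ ∧ x_{t m}` for a tuple
of `m + 1` indices; the position `j` counts from `0` here and from `1` in the formula. -/
noncomputable def boundary {l m : ℕ} (t : Fin (m + 1) → Fin l) : Ext l :=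
  ∑ j : Fin (m + 1), (-1 : ℂ) ^ ((j : ℕ) + 1) • monomial (t ∘ j.succAbove)

variable {n l : ℕ} (𝒜 : ProjArrangement n l)

/-- The intersection of a tuple of hyperplanes (for the empty tuple, the whole space). -/
def inter {m : ℕ} (t : Fin m → Fin l) : Submodule ℂ (Fin (n + 1) → ℂ) :=
  ⨅ j, 𝒜.hyp (t j)

/-- The hyperplanes of the tuple have a common point, and their intersection has codimension
smaller than the number of hyperplanes. -/
def NonGeneric {m : ℕ} (t : Fin m → Fin l) : Prop :=
  𝒜.inter t ≠ ⊥ ∧ n + 1 < Module.finrank ℂ (𝒜.inter t) + m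

/-- The ideal `K` generated by `∂(x_{t 1} ∧ ⋯ ∧ x_{t m})` for the tuples of distinct hyperplanes
that intersect non-generically and by the monomials `x_{t 1} ∧ ⋯ ∧ x_{t m}` for the tuples of
distinct hyperplanes without common point in `ℂP^n`. -/
def osIdeal : TwoSidedIdeal (Ext l) :=
  TwoSidedIdeal.span
    ({a | ∃ (m : ℕ) (t : Fin (m + 1) → Fin l),
        Function.Injective t ∧ 𝒜.NonGeneric t ∧ a = boundary t} ∪
      {a | ∃ (m : ℕ) (t : Fin m → Fin l),
        Function.Injective t ∧ 𝒜.inter t = ⊥ ∧ a = monomial t})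

/-- The Orlik-Solomon algebra `A = E / K`. -/
abbrev OS : Type := 𝒜.osIdeal.ringCon.Quotient

/-- The canonical generator `x_i` of the Orlik-Solomon algebra. -/
def gen (i : Fin l) : 𝒜.OS :=
  ((ExteriorAlgebra.ι ℂ (Pi.single i 1 : Fin l → ℂ) : Ext l) : 𝒜.osIdeal.ringCon.Quotient)

/-- The homogeneous part `A^1` of degree one. -/
def degreeOne : Submodule ℂ 𝒜.OS := Submodule.span ℂ (Set.range 𝒜.gen)

/-- `V` is `k`-isotropic: the product of any `k` vectors of `V` vanishes. -/
def IsIsotropic (k : ℕ) (V : Submodule ℂ 𝒜.OS) : Prop :=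
  ∀ w : Fin k → 𝒜.OS, (∀ i, w i ∈ V) → (List.ofFn w).prod = 0

/-- `S` is a flat, that is, a (nonempty) intersection of hyperplanes of the arrangement. -/
def IsFlat (S : Submodule ℂ (Fin (n + 1) → ℂ)) : Prop :=
  S ≠ ⊥ ∧ ∃ T : Set (Fin l), S = ⨅ i ∈ T, 𝒜.hyp i

/-- `S_k ⊃ ⋯ ⊃ S_1` is a truncated flag of length `k` of the intersection lattice, where
`dim S_i = i + n - k` as linear subspaces of `ℂ^(n+1)`. The subspace `S_i` of the usual numbering
is `S (i - 1)`. -/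
structure IsTruncatedFlag {k : ℕ} (S : Fin k → Submodule ℂ (Fin (n + 1) → ℂ)) : Prop where
  isFlat : ∀ i, 𝒜.IsFlat (S i)
  strictMono : StrictMono S
  finrank_add : ∀ i : Fin k, Module.finrank ℂ (S i) + k = ((i : ℕ) + 1) + n

open Classical in
/-- The decoration `v_S`, the sum of the columns `v_i` of `M` over all `i` with `H_i ⊇ S`. -/
noncomputable def decoration {r : ℕ} (M : Matrix (Fin r) (Fin l) ℂ)
    (S : Submodule ℂ (Fin (n + 1) → ℂ)) : Fin r → ℂ :=
  ∑ i with S ≤ 𝒜.hyp i, M.col i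

end ProjArrangement

/-! ### Exterior monomials and their images in the Orlik–Solomon algebra. -/

namespace ProjArrangement

open ExteriorAlgebra Module

variable {n l : ℕ} (𝒜 : ProjArrangement n l)

/-! Each truncated flag gives a residue on degree `k` of `A`, and these residues together detect
zero. Along a chain, `flagMap` sends `x_i` to a vector (1,…,1,0,…,0) whose number of ones is the
depth of `H_i`. Hyperplanes of distinct depths are in general position, so a non-generic tuple
repeats a vector and its boundary dies; in a tuple with empty intersection some vector is zero.
Hence `flagHom` kills the ideal, and the determinant in degree `k` descends to `A`
(`residue_eq_of_proj_eq`). Conversely, monomials without broken circuits span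
(`proj_monomial_mem_span_nbc`), and their residues along their own tail flags form a unitriangular
system (`eq_zero_of_residue_eq_zero`). So a product of `k` vectors vanishes iff all its flag
determinants do. For vectors from the row space of `M`, this says that the image under `flagMap` is
not all of `ℂ^k`; by row rank = column rank, the decorations then span less than `k` dimensions. -/

/-- The projection from the exterior algebra onto the Orlik-Solomon algebra. -/
noncomputable def proj : Ext l →ₐ[ℂ] 𝒜.OS := RingCon.mkₐ ℂ 𝒜.osIdeal.ringCon

theorem proj_eq_iff {x y : Ext l} : 𝒜.proj x = 𝒜.proj y ↔ x - y ∈ 𝒜.osIdeal := by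
  rw [← TwoSidedIdeal.rel_iff]
  exact RingCon.eq _

theorem proj_eq_zero_iff {x : Ext l} : 𝒜.proj x = 0 ↔ x ∈ 𝒜.osIdeal := by
  rw [← map_zero 𝒜.proj, proj_eq_iff, sub_zero]

theorem proj_ι (w : Fin l → ℂ) : 𝒜.proj (ι ℂ w) = ∑ i, w i • 𝒜.gen i := by
  conv_lhs => rw [pi_eq_sum_univ' w]
  simp only [map_sum, map_smul]
  rfl

theorem proj_ιMulti {k : ℕ} (w : Fin k → Fin l → ℂ) :
    𝒜.proj (ιMulti ℂ k w) = (List.ofFn fun j => 𝒜.proj (ι ℂ (w j))).prod := by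
  rw [ιMulti_apply, map_list_prod, List.map_ofFn]
  rfl

theorem monomial_mul_monomial {p q : ℕ} (a : Fin p → Fin l) (b : Fin q → Fin l) :
    monomial a * monomial b = monomial (Fin.append a b) := by
  rw [monomial, monomial, ιMulti_mul_ιMulti, monomial]
  congr 1
  ext j : 1
  refine Fin.addCases (fun i => ?_) (fun i => ?_) j <;> simp

theorem monomial_eq_zero {m : ℕ} {t : Fin m → Fin l} (ht : ¬ Function.Injective t) :
    monomial t = 0 :=
  ιMulti_eq_zero_of_not_inj fun h => ht fun a b hab => h (by simp [hab])

theorem monomial_comp_perm {m : ℕ} (t : Fin m → Fin l) (σ : Equiv.Perm (Fin m)) :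
    monomial (t ∘ σ) = Equiv.Perm.sign σ • monomial t :=
  (ιMulti ℂ m).map_perm (fun j => (Pi.single (t j) 1 : Fin l → ℂ)) σ

theorem ιMulti_mem_span_monomial {k : ℕ} (w : Fin k → Fin l → ℂ) :
    ιMulti ℂ k w ∈ Submodule.span ℂ (Set.range (monomial (l := l) (m := k))) := by
  have h : w = fun j => ∑ i, w j i • (Pi.single i 1 : Fin l → ℂ) :=
    funext fun j => pi_eq_sum_univ' (w j)
  rw [h, ← AlternatingMap.coe_multilinearMap, MultilinearMap.map_sum]
  refine Submodule.sum_mem _ fun t _ => ?_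
  rw [MultilinearMap.map_smul_univ]
  exact Submodule.smul_mem _ _ (Submodule.subset_span ⟨t, rfl⟩)

/-! ### Dimensions of intersections -/

theorem finrank_le_finrank_hyp_inf_add_one (S : Submodule ℂ (Fin (n + 1) → ℂ)) (i : Fin l) :
    finrank ℂ S ≤ finrank ℂ (𝒜.hyp i ⊓ S : Submodule ℂ (Fin (n + 1) → ℂ)) + 1 := by
  have h := Submodule.finrank_sup_add_finrank_inf_eq (𝒜.hyp i) S
  have h' := Submodule.finrank_le (𝒜.hyp i ⊔ S)
  rw [𝒜.finrank_hyp] at h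
  simp only [finrank_fintype_fun_eq_card, Fintype.card_fin] at h'
  omega

theorem biInf_hyp_empty : (⨅ i ∈ (∅ : Finset (Fin l)), 𝒜.hyp i) = ⊤ := by simp

theorem le_finrank_biInf_add_card (T : Finset (Fin l)) :
    n + 1 ≤ finrank ℂ (⨅ i ∈ T, 𝒜.hyp i : Submodule ℂ (Fin (n + 1) → ℂ)) + T.card := by
  induction T using Finset.induction_on with
  | empty => rw [biInf_hyp_empty, finrank_top]; simp
  | insert a s ha ih =>
    have h := 𝒜.finrank_le_finrank_hyp_inf_add_one (⨅ i ∈ s, 𝒜.hyp i) a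
    rw [Finset.card_insert_of_notMem ha, Finset.iInf_insert]
    omega

theorem inter_eq_biInf_image {m : ℕ} (t : Fin m → Fin l) :
    𝒜.inter t = ⨅ i ∈ Finset.univ.image t, 𝒜.hyp i := by
  rw [Finset.iInf_finset_image]
  simp [inter]

theorem le_finrank_inter_add {m : ℕ} (t : Fin m → Fin l) :
    n + 1 ≤ finrank ℂ (𝒜.inter t) + m := by
  have h := 𝒜.le_finrank_biInf_add_card (Finset.univ.image t)
  rw [← inter_eq_biInf_image] at h
  have h' : (Finset.univ.image t).card ≤ m := Finset.card_image_le.trans (by simp)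
  omega

/-! ### The residue along a chain of subspaces -/

section Residue

variable {k : ℕ} (S : Fin k → Submodule ℂ (Fin (n + 1) → ℂ))

open Classical in
/-- The linear map which sums, for each member of a chain, the coefficients of the hyperplanes
containing that member. -/
noncomputable def flagMap : (Fin l → ℂ) →ₗ[ℂ] (Fin k → ℂ) :=
  LinearMap.pi fun p => ∑ i with S p ≤ 𝒜.hyp i, LinearMap.proj i

open Classical in
theorem flagMap_apply (w : Fin l → ℂ) (p : Fin k) :
    𝒜.flagMap S w p = ∑ i with S p ≤ 𝒜.hyp i, w i := by
  simp [flagMap]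

open Classical in
theorem flagMap_single (i : Fin l) (p : Fin k) :
    𝒜.flagMap S (Pi.single i 1) p = if S p ≤ 𝒜.hyp i then 1 else 0 := by
  simp [flagMap_apply]

open Classical in
/-- The number of members of a chain contained in a hyperplane. -/
noncomputable def depth (i : Fin l) : ℕ := (Finset.univ.filter fun p => S p ≤ 𝒜.hyp i).card

variable {S}

/-- The members lying in a fixed hyperplane form an initial segment of the chain, so their number
determines them. -/
theorem le_hyp_iff_lt_depth (hS : Monotone S) (i : Fin l) (p : Fin k) :
    S p ≤ 𝒜.hyp i ↔ (p : ℕ) < 𝒜.depth S i := by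
  classical
  constructor
  · intro h
    have : Finset.Iic p ⊆ Finset.univ.filter fun p => S p ≤ 𝒜.hyp i := fun q hq => by
      simpa using (hS (Finset.mem_Iic.1 hq)).trans h
    have := Finset.card_le_card this
    rw [Fin.card_Iic] at this
    exact this
  · intro h
    by_contra hp
    have : (Finset.univ.filter fun p => S p ≤ 𝒜.hyp i) ⊆ Finset.Iio p := fun q hq => by
      rw [Finset.mem_Iio]
      by_contra hqp
      exact hp ((hS (not_lt.1 hqp)).trans (Finset.mem_filter.1 hq).2)
    have := Finset.card_le_card this
    rw [Fin.card_Iio] at this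
    exact absurd h (not_lt.2 this)

theorem depth_le (i : Fin l) : 𝒜.depth S i ≤ k := by
  classical
  exact (Finset.card_le_univ _).trans (by simp)

theorem flagMap_single_eq_of_depth_eq (hS : Monotone S) {i j : Fin l}
    (h : 𝒜.depth S i = 𝒜.depth S j) :
    𝒜.flagMap S (Pi.single i 1) = 𝒜.flagMap S (Pi.single j 1) := by
  ext p
  simp only [flagMap_single, 𝒜.le_hyp_iff_lt_depth hS, h]

/-- Adding hyperplanes by decreasing depth, each new one cuts the dimension: the earlier ones all
contain a member of the chain that the new one does not. -/
theorem finrank_biInf_add_card_le (hS : Monotone S) (T : Finset (Fin l)) :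
    Set.InjOn (𝒜.depth S) T →
      finrank ℂ (⨅ i ∈ T, 𝒜.hyp i : Submodule ℂ (Fin (n + 1) → ℂ)) + T.card ≤ n + 1 := by
  induction T using Finset.induction_on_min_value (𝒜.depth S) with
  | empty => intro _; rw [biInf_hyp_empty, finrank_top]; simp
  | insert a s ha hmin ih =>
    intro hinj
    have hs := ih (hinj.mono (by simp))
    rw [Finset.card_insert_of_notMem ha, Finset.iInf_insert]
    suffices h : ¬ (⨅ i ∈ s, 𝒜.hyp i) ≤ 𝒜.hyp a by
      have := Submodule.finrank_lt_finrank_of_lt (inf_lt_right.2 h)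
      omega
    intro hle
    rcases s.eq_empty_or_nonempty with rfl | ⟨b, hb⟩
    · rw [biInf_hyp_empty] at hle
      have := Submodule.finrank_mono hle
      rw [finrank_top, 𝒜.finrank_hyp] at this
      simp at this
    · have hlt : ∀ x ∈ s, 𝒜.depth S a < 𝒜.depth S x := fun x hx =>
        lt_of_le_of_ne (hmin x hx) fun h => ha (by
          rwa [hinj (by simp) (by simp [hx]) h])
      have hk := (hlt b hb).trans_le (𝒜.depth_le b)
      -- Counting from 0, the member with index `depth S a` is the first one not inside `H_a`.
      refine lt_irrefl (𝒜.depth S a) ((𝒜.le_hyp_iff_lt_depth hS a ⟨_, hk⟩).1 (le_trans ?_ hle))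
      exact le_iInf₂ fun x hx => (𝒜.le_hyp_iff_lt_depth hS x ⟨_, hk⟩).2 (hlt x hx)

theorem exists_depth_eq_of_nonGeneric (hS : Monotone S) {m : ℕ} {t : Fin m → Fin l}
    (ht : Function.Injective t) (h : 𝒜.NonGeneric t) :
    ∃ a b, a ≠ b ∧ 𝒜.depth S (t a) = 𝒜.depth S (t b) := by
  by_contra! hne
  have := 𝒜.finrank_biInf_add_card_le hS (Finset.univ.image t) (by
    intro x hx y hy hxy
    simp only [Finset.coe_image, Finset.coe_univ, Set.image_univ, Set.mem_range] at hx hy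
    obtain ⟨a, rfl⟩ := hx
    obtain ⟨b, rfl⟩ := hy
    by_contra hab
    exact hne a b (fun h => hab (by rw [h])) hxy)
  rw [← inter_eq_biInf_image, Finset.card_image_of_injective _ ht, Finset.card_fin] at this
  exact absurd h.2 (not_lt.2 this)

/-- The alternating sum of the products omitting one vector vanishes as soon as two of the vectors
agree. -/
theorem sum_neg_one_pow_smul_ιMulti_removeNth_eq_zero {E : Type*} [AddCommGroup E] [Module ℂ E]
    {m : ℕ} (v : Fin (m + 1) → E) {a b : Fin (m + 1)} (hab : a ≠ b) (hv : v a = v b) :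
    ∑ j : Fin (m + 1), (-1 : ℤ) ^ (j : ℕ) • ιMulti ℂ m (v ∘ j.succAbove) = 0 := by
  rw [Fintype.sum_eq_add a b hab]
  · exact AlternatingMap.neg_one_pow_smul_map_removeNth_add_eq_zero_of_eq (ιMulti ℂ m) hv hab
  · rintro j ⟨hja, hjb⟩
    obtain ⟨a', rfl⟩ := Fin.exists_succAbove_eq hja.symm
    obtain ⟨b', rfl⟩ := Fin.exists_succAbove_eq hjb.symm
    rw [(ιMulti ℂ m).map_eq_zero_of_eq _ hv fun h => hab (by rw [h]), smul_zero]

variable (S) in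
/-- The algebra homomorphism of exterior algebras induced by `flagMap`. -/
noncomputable def flagHom : Ext l →ₐ[ℂ] Ext k := ExteriorAlgebra.map (𝒜.flagMap S)

theorem flagHom_monomial {m : ℕ} (t : Fin m → Fin l) :
    𝒜.flagHom S (monomial t) = ιMulti ℂ m fun j => 𝒜.flagMap S (Pi.single (t j) 1) :=
  map_apply_ιMulti _ _

theorem flagHom_boundary (hS : Monotone S) {m : ℕ} {t : Fin (m + 1) → Fin l}
    (ht : Function.Injective t) (h : 𝒜.NonGeneric t) : 𝒜.flagHom S (boundary t) = 0 := by
  obtain ⟨a, b, hab, hd⟩ := 𝒜.exists_depth_eq_of_nonGeneric hS ht h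
  have := sum_neg_one_pow_smul_ιMulti_removeNth_eq_zero
    (fun j => 𝒜.flagMap S (Pi.single (t j) 1)) hab (𝒜.flagMap_single_eq_of_depth_eq hS hd)
  -- The signs of `boundary` are `(-1)^(j+1)`, opposite to those of the vanishing sum.
  rw [boundary, map_sum, ← neg_eq_zero, ← this, ← Finset.sum_neg_distrib]
  refine Finset.sum_congr rfl fun j _ => ?_
  rw [map_smul, flagHom_monomial, pow_succ, mul_neg_one, neg_smul, neg_neg,
    ← Int.cast_smul_eq_zsmul ℂ]
  push_cast
  rfl

theorem flagHom_monomial_eq_zero (hS : Monotone S) (hbot : ∀ p, S p ≠ ⊥) {m : ℕ}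
    {t : Fin m → Fin l} (h : 𝒜.inter t = ⊥) : 𝒜.flagHom S (monomial t) = 0 := by
  rw [flagHom_monomial]
  suffices h : ∃ j, 𝒜.flagMap S (Pi.single (t j) 1) = 0 from
    h.elim fun j hj => (ιMulti ℂ m).map_coord_zero j hj
  rcases k with _ | k
  · rcases m with _ | m
    · exact absurd (((iInf_of_empty _).symm.trans h : (⊤ : Submodule ℂ (Fin (n + 1) → ℂ)) = ⊥))
        top_ne_bot
    · exact ⟨0, Subsingleton.elim _ _⟩
  -- A hyperplane missing the smallest member `S 0` contains no member, so its vector is zero.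
  · have : ∃ j, ¬ S 0 ≤ 𝒜.hyp (t j) := by
      by_contra! hle
      exact hbot 0 (le_bot_iff.1 (h ▸ le_iInf hle))
    obtain ⟨j, hj⟩ := this
    refine ⟨j, funext fun p => ?_⟩
    rw [flagMap_single, if_neg fun hp => hj ((hS (Fin.zero_le p)).trans hp)]
    rfl

theorem flagHom_eq_zero_of_mem (hS : Monotone S) (hbot : ∀ p, S p ≠ ⊥) {x : Ext l}
    (hx : x ∈ 𝒜.osIdeal) : 𝒜.flagHom S x = 0 := by
  rw [osIdeal, TwoSidedIdeal.mem_span_iff] at hx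
  have := hx (TwoSidedIdeal.ker (𝒜.flagHom S)) (by
    rintro _ (⟨m, t, ht, h, rfl⟩ | ⟨m, t, -, h, rfl⟩) <;>
      simp only [SetLike.mem_coe, TwoSidedIdeal.mem_ker]
    · exact 𝒜.flagHom_boundary hS ht h
    · exact 𝒜.flagHom_monomial_eq_zero hS hbot h)
  exact (TwoSidedIdeal.mem_ker _).1 this

variable (S) in
/-- The residue along a chain of `k` subspaces, a linear functional supported in degree `k`. -/
noncomputable def residue : Ext l →ₗ[ℂ] ℂ :=
  liftAlternating (Function.update 0 k Matrix.detRowAlternating) ∘ₗ (𝒜.flagHom S).toLinearMap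

theorem residue_ιMulti (w : Fin k → Fin l → ℂ) :
    𝒜.residue S (ιMulti ℂ k w) = Matrix.det (Matrix.of fun j => 𝒜.flagMap S (w j)) := by
  rw [residue, LinearMap.comp_apply, AlgHom.toLinearMap_apply, flagHom, map_apply_ιMulti,
    liftAlternating_apply_ιMulti, Function.update_self]
  rfl

theorem residue_eq_of_proj_eq (hS : Monotone S) (hbot : ∀ p, S p ≠ ⊥) {x y : Ext l}
    (h : 𝒜.proj x = 𝒜.proj y) : 𝒜.residue S x = 𝒜.residue S y := by
  rw [← sub_eq_zero, ← map_sub, residue, LinearMap.comp_apply, AlgHom.toLinearMap_apply,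
    𝒜.flagHom_eq_zero_of_mem hS hbot (𝒜.proj_eq_iff.1 h), map_zero]

end Residue

/-! ### Monomials without broken circuits -/

/-- The member with index `p` of the chain of intersections of the tails of a tuple. -/
def tailFlag {k : ℕ} (s : Fin k → Fin l) (p : Fin k) : Submodule ℂ (Fin (n + 1) → ℂ) :=
  ⨅ j, ⨅ _ : p ≤ j, 𝒜.hyp (s j)

/-- An increasing tuple of hyperplanes with a common point contains no broken circuit: every
member is the first hyperplane containing the intersection of the tail which it starts. -/
structure IsNbc {k : ℕ} (s : Fin k → Fin l) : Prop where
  strictMono : StrictMono s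
  inter_ne_bot : 𝒜.inter s ≠ ⊥
  le_of_tailFlag_le : ∀ p i, 𝒜.tailFlag s p ≤ 𝒜.hyp i → s p ≤ i

section Nbc

variable {𝒜} {k : ℕ} {s : Fin k → Fin l}

theorem tailFlag_le_hyp {p j : Fin k} (h : p ≤ j) : 𝒜.tailFlag s p ≤ 𝒜.hyp (s j) :=
  iInf₂_le j h

theorem inter_le_tailFlag (p : Fin k) : 𝒜.inter s ≤ 𝒜.tailFlag s p :=
  le_iInf₂ fun j _ => iInf_le _ j

theorem tailFlag_monotone : Monotone (𝒜.tailFlag s) := fun _ _ h =>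
  le_iInf₂ fun _ hj => tailFlag_le_hyp (h.trans hj)

theorem IsNbc.tailFlag_le_hyp_iff (hs : 𝒜.IsNbc s) (p j : Fin k) :
    𝒜.tailFlag s p ≤ 𝒜.hyp (s j) ↔ p ≤ j :=
  ⟨fun h => hs.strictMono.le_iff_le.1 (hs.le_of_tailFlag_le p _ h), tailFlag_le_hyp⟩

theorem tailFlag_eq_biInf_image (s : Fin k → Fin l) (p : Fin k) :
    𝒜.tailFlag s p = ⨅ i ∈ (Finset.Ici p).image s, 𝒜.hyp i := by
  rw [Finset.iInf_finset_image]
  simp [tailFlag]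

theorem IsNbc.depth_tailFlag (hs : 𝒜.IsNbc s) (j : Fin k) :
    𝒜.depth (𝒜.tailFlag s) (s j) = j + 1 := by
  classical
  simp only [depth, hs.tailFlag_le_hyp_iff]
  rw [← Fin.card_Iic j]
  congr 1
  ext; simp

/-- The dimensions are exact because the hyperplanes of `s` have distinct depths along their own
tail flag, hence are in general position. -/
theorem IsNbc.isTruncatedFlag (hs : 𝒜.IsNbc s) : 𝒜.IsTruncatedFlag (𝒜.tailFlag s) where
  isFlat p := ⟨fun h => hs.inter_ne_bot (le_bot_iff.1 (h ▸ inter_le_tailFlag p)),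
    _, tailFlag_eq_biInf_image s p⟩
  strictMono p q hpq := by
    refine lt_of_le_of_ne (tailFlag_monotone hpq.le) fun h => ?_
    exact not_le.2 hpq ((hs.tailFlag_le_hyp_iff q p).1 (h ▸ tailFlag_le_hyp le_rfl))
  finrank_add p := by
    have hcard : ((Finset.Ici p).image s).card = k - p := by
      rw [Finset.card_image_of_injective _ hs.strictMono.injective, Fin.card_Ici]
    have h₁ := 𝒜.le_finrank_biInf_add_card ((Finset.Ici p).image s)
    have h₂ := 𝒜.finrank_biInf_add_card_le (S := 𝒜.tailFlag s) tailFlag_monotone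
      ((Finset.Ici p).image s) (by
        intro x hx y hy hxy
        simp only [Finset.coe_image, Set.mem_image] at hx hy
        obtain ⟨a, -, rfl⟩ := hx
        obtain ⟨b, -, rfl⟩ := hy
        rw [hs.depth_tailFlag, hs.depth_tailFlag, add_left_inj, Fin.val_inj] at hxy
        rw [hxy])
    rw [← tailFlag_eq_biInf_image, hcard] at h₁ h₂
    have := p.isLt
    omega

theorem IsNbc.residue_self (hs : 𝒜.IsNbc s) :
    𝒜.residue (𝒜.tailFlag s) (monomial s) = 1 := by
  classical
  rw [monomial, residue_ιMulti, Matrix.det_of_isLowerTriangular]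
  · simp [flagMap_single, tailFlag_le_hyp]
  · intro i j hij
    have : j > i := hij
    simp [flagMap_single, hs.tailFlag_le_hyp_iff, this]

/-- A nonzero term of the determinant matches `t` with `s` so that `s p ≤ t (σ p)` for all `p`;
equal index sums force equal ranges. -/
theorem IsNbc.eq_or_sum_lt (hs : 𝒜.IsNbc s) {t : Fin k → Fin l} (ht : StrictMono t)
    (h : 𝒜.residue (𝒜.tailFlag s) (monomial t) ≠ 0) :
    t = s ∨ ∑ j, (s j : ℕ) < ∑ j, (t j : ℕ) := by
  classical
  rw [monomial, residue_ιMulti, Matrix.det_apply] at h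
  obtain ⟨σ, -, hσ⟩ := Finset.exists_ne_zero_of_sum_ne_zero h
  have hle : ∀ p, s p ≤ t (σ p) := fun p => by
    refine hs.le_of_tailFlag_le p _ ?_
    by_contra hp
    refine hσ ?_
    rw [Finset.prod_eq_zero (Finset.mem_univ p), smul_zero]
    simp [flagMap_single, hp]
  rw [← Equiv.sum_comp σ fun j => (t j : ℕ)]
  refine or_iff_not_imp_right.2 fun hlt => ?_
  have heq : ∀ p, s p = t (σ p) := by
    by_contra! hne
    obtain ⟨p, hp⟩ := hne
    exact hlt (Finset.sum_lt_sum (fun q _ => hle q)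
      ⟨p, Finset.mem_univ p, lt_of_le_of_ne (hle p) (Fin.val_ne_of_ne hp)⟩)
  refine StrictMono.range_inj ht hs.strictMono |>.1 ?_
  rw [← σ.surjective.range_comp t]
  exact congrArg Set.range (funext fun p => (heq p).symm)

theorem eq_zero_of_residue_eq_zero {y : Ext l}
    (hy : y ∈ Submodule.span ℂ (monomial '' {s : Fin k → Fin l | 𝒜.IsNbc s}))
    (h : ∀ s : Fin k → Fin l, 𝒜.IsNbc s → 𝒜.residue (𝒜.tailFlag s) y = 0) : y = 0 := by
  classical
  rw [Set.image_eq_range, Submodule.mem_span_range_iff_exists_fun] at hy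
  obtain ⟨c, rfl⟩ := hy
  suffices hc : c = 0 by simp [hc]
  by_contra hc
  obtain ⟨s₀, hs₀⟩ := Function.ne_iff.1 hc
  -- With the index sum maximal, no other monomial contributes to the residue along the tail flag of
  -- `s`, which therefore equals `c s`.
  obtain ⟨s, hs, hmax⟩ := Finset.exists_max_image (Finset.univ.filter fun s => c s ≠ 0)
    (fun s => ∑ j, (s.1 j : ℕ)) ⟨s₀, by simpa using hs₀⟩
  have hs' := h s.1 s.2
  rw [map_sum, Fintype.sum_eq_single s] at hs'
  · rw [map_smul, IsNbc.residue_self s.2, smul_eq_mul, mul_one] at hs'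
    exact (Finset.mem_filter.1 hs).2 hs'
  · intro t hts
    rw [map_smul]
    by_contra hne
    rw [smul_eq_mul, mul_eq_zero, not_or] at hne
    rcases IsNbc.eq_or_sum_lt s.2 t.2.strictMono hne.2 with heq | hlt
    · exact hts (Subtype.ext heq)
    · exact not_lt.2 (hmax t (by simp [hne.1])) hlt

end Nbc

/-! ### Reduction to monomials without broken circuits -/

theorem boundary_cons {q : ℕ} (i : Fin l) (b : Fin (q + 1) → Fin l) :
    boundary (Fin.cons i b : Fin (q + 2) → Fin l) = -monomial b +
      ∑ j : Fin (q + 1), (-1 : ℂ) ^ ((j : ℕ) + 2) •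
        monomial ((Fin.cons i b : Fin (q + 2) → Fin l) ∘ j.succ.succAbove) := by
  rw [boundary, Fin.sum_univ_succ]
  congr 1
  simp

theorem sum_val_append {p q : ℕ} (a : Fin p → Fin l) (b : Fin q → Fin l) :
    ∑ j, ((Fin.append a b j : Fin l) : ℕ) = ∑ j, (a j : ℕ) + ∑ j, (b j : ℕ) := by
  simp [Fin.sum_univ_add]

/-- The boundary relation of `i` followed by `b` trades `b` for tuples in which some `b j` is
replaced by the smaller `i`. -/
theorem proj_monomial_mem_of_not_le {p q : ℕ} (a : Fin p → Fin l) (b : Fin (q + 1) → Fin l)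
    {i : Fin l} (hb : StrictMono b) (hi : i < b 0) (hbot : 𝒜.inter b ≠ ⊥)
    (hle : 𝒜.inter b ≤ 𝒜.hyp i) :
    𝒜.proj (monomial (Fin.append a b)) ∈ Submodule.span ℂ
      ((fun t => 𝒜.proj (monomial t)) '' {t : Fin (p + (q + 1)) → Fin l |
        ∑ j, (t j : ℕ) < ∑ j, ((Fin.append a b j : Fin l) : ℕ)}) := by
  have hinter : 𝒜.inter (Fin.cons i b : Fin (q + 2) → Fin l) = 𝒜.inter b := by
    refine le_antisymm (le_iInf fun j => (iInf_le _ j.succ).trans (by simp)) (le_iInf fun j => ?_)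
    refine Fin.cases (by simpa using hle) (fun j => ?_) j
    exact iInf_le (fun j => 𝒜.hyp (b j)) j
  have hmem : boundary (Fin.cons i b : Fin (q + 2) → Fin l) ∈ 𝒜.osIdeal := by
    refine TwoSidedIdeal.subset_span (Or.inl ⟨_, _, ?_, ⟨?_, ?_⟩, rfl⟩)
    · refine Fin.cons_injective_iff.2 ⟨?_, hb.injective⟩
      rintro ⟨j, rfl⟩
      exact not_le.2 hi (hb.monotone (Fin.zero_le j))
    · rwa [hinter]
    · rw [hinter]
      have := 𝒜.le_finrank_inter_add b
      omega
  have h := 𝒜.proj_eq_zero_iff.2 (𝒜.osIdeal.mul_mem_left (monomial a) _ hmem)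
  rw [boundary_cons, mul_add, mul_neg, monomial_mul_monomial, map_add, map_neg,
    neg_add_eq_zero] at h
  rw [h, Finset.mul_sum, map_sum]
  refine Submodule.sum_mem _ fun j _ => ?_
  rw [mul_smul_comm, map_smul, monomial_mul_monomial]
  refine Submodule.smul_mem _ _ (Submodule.subset_span ⟨_, ?_, rfl⟩)
  have hsum := Fin.sum_univ_succAbove
    (fun j => ((Fin.cons i b : Fin (q + 2) → Fin l) j : ℕ)) j.succ
  rw [Fin.sum_univ_succ] at hsum
  simp only [Fin.cons_zero, Fin.cons_succ] at hsum
  have hij : (i : ℕ) < b j := hi.trans_le (hb.monotone (Fin.zero_le j))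
  rw [Set.mem_ofPred_eq, sum_val_append, sum_val_append]
  simp only [Function.comp_apply]
  omega

theorem proj_monomial_mem_of_not_isNbc {k : ℕ} {s : Fin k → Fin l} (hs : StrictMono s)
    (hbot : 𝒜.inter s ≠ ⊥) (h : ¬ 𝒜.IsNbc s) :
    𝒜.proj (monomial s) ∈ Submodule.span ℂ
      ((fun t => 𝒜.proj (monomial t)) '' {t : Fin k → Fin l |
        ∑ j, (t j : ℕ) < ∑ j, (s j : ℕ)}) := by
  have : ∃ p i, 𝒜.tailFlag s p ≤ 𝒜.hyp i ∧ i < s p := by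
    by_contra! hne
    exact h ⟨hs, hbot, hne⟩
  obtain ⟨⟨p, hp⟩, i, hle, hi⟩ := this
  -- Cut `s` where the offending tail starts; that tail plays the role of `b`.
  obtain ⟨q, rfl⟩ : ∃ q, k = p + (q + 1) := ⟨k - p - 1, by omega⟩
  have hb : StrictMono fun j => s (Fin.natAdd p j) := fun x y hxy =>
    hs ((Fin.strictMono_natAdd p) hxy)
  have hinter : 𝒜.inter (fun j => s (Fin.natAdd p j)) = 𝒜.tailFlag s ⟨p, hp⟩ := by
    refine le_antisymm (le_iInf₂ fun j hj => ?_) (le_iInf fun j => tailFlag_le_hyp ?_)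
    · refine (iInf_le _ (⟨j - p, by have := j.isLt; omega⟩ : Fin (q + 1))).trans (le_of_eq ?_)
      have : p ≤ (j : ℕ) := hj
      have hj' : Fin.natAdd p (⟨j - p, by have := j.isLt; omega⟩ : Fin (q + 1)) = j := by
        ext
        simp only [Fin.natAdd_mk]
        omega
      exact congrArg (fun x => 𝒜.hyp (s x)) hj'
    · simp [Fin.le_def]
  have := 𝒜.proj_monomial_mem_of_not_le (fun j => s (Fin.castAdd (q + 1) j))
    (fun j => s (Fin.natAdd p j)) hb (i := i) (by
      rwa [show Fin.natAdd p (0 : Fin (q + 1)) = ⟨p, hp⟩ from rfl]) (by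
      rw [hinter]
      exact fun h' => hbot (le_bot_iff.1 (h' ▸ inter_le_tailFlag _))) (by rwa [hinter])
  rwa [Fin.append_castAdd_natAdd] at this

theorem proj_monomial_mem_span_nbc {k : ℕ} (t : Fin k → Fin l) :
    𝒜.proj (monomial t) ∈ Submodule.span ℂ
      ((fun s => 𝒜.proj (monomial s)) '' {s : Fin k → Fin l | 𝒜.IsNbc s}) := by
  induction hN : ∑ j, (t j : ℕ) using Nat.strong_induction_on generalizing t with
  | _ N ih =>
    subst hN
    by_cases hinj : Function.Injective t
    swap
    · rw [monomial_eq_zero hinj, map_zero]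
      exact Submodule.zero_mem _
    -- Sorting changes the monomial only by a sign and keeps the index sum, the induction measure.
    set σ := Tuple.sort t
    have hs : StrictMono (t ∘ σ) :=
      (Tuple.monotone_sort t).strictMono_of_injective (hinj.comp σ.injective)
    have hsum : ∑ j, ((t ∘ σ) j : ℕ) = ∑ j, (t j : ℕ) := Equiv.sum_comp σ fun j => (t j : ℕ)
    suffices h : 𝒜.proj (monomial (t ∘ σ)) ∈ Submodule.span ℂ
        ((fun s => 𝒜.proj (monomial s)) '' {s : Fin k → Fin l | 𝒜.IsNbc s}) by
      rw [monomial_comp_perm] at h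
      rcases Int.units_eq_one_or (Equiv.Perm.sign σ) with h1 | h1 <;> rw [h1] at h
      · simpa using h
      · simpa using h
    by_cases hbot : 𝒜.inter (t ∘ σ) = ⊥
    · rw [𝒜.proj_eq_zero_iff.2
        (TwoSidedIdeal.subset_span (Or.inr ⟨_, _, hs.injective, hbot, rfl⟩))]
      exact Submodule.zero_mem _
    by_cases hnbc : 𝒜.IsNbc (t ∘ σ)
    · exact Submodule.subset_span ⟨_, hnbc, rfl⟩
    refine Submodule.span_le.2 ?_ (𝒜.proj_monomial_mem_of_not_isNbc hs hbot hnbc)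
    rintro _ ⟨u, hu, rfl⟩
    exact ih _ (hsum ▸ hu) u rfl

theorem proj_ιMulti_eq_zero_iff {k : ℕ} (w : Fin k → Fin l → ℂ) :
    𝒜.proj (ιMulti ℂ k w) = 0 ↔ ∀ S : Fin k → Submodule ℂ (Fin (n + 1) → ℂ),
      𝒜.IsTruncatedFlag S → Matrix.det (Matrix.of fun j => 𝒜.flagMap S (w j)) = 0 := by
  constructor
  · intro h S hS
    rw [← residue_ιMulti, 𝒜.residue_eq_of_proj_eq hS.strictMono.monotone
      (fun p => (hS.isFlat p).1) (h.trans (map_zero 𝒜.proj).symm), map_zero]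
  · intro h
    have hmem : 𝒜.proj (ιMulti ℂ k w) ∈ Submodule.span ℂ
        ((fun s => 𝒜.proj (monomial s)) '' {s : Fin k → Fin l | 𝒜.IsNbc s}) := by
      refine (Submodule.span_le (p := Submodule.comap 𝒜.proj.toLinearMap (Submodule.span ℂ
        ((fun s => 𝒜.proj (monomial s)) '' {s : Fin k → Fin l | 𝒜.IsNbc s})))).2 ?_
        (ιMulti_mem_span_monomial w)
      rintro _ ⟨t, rfl⟩
      exact 𝒜.proj_monomial_mem_span_nbc t
    rw [← Set.image_image 𝒜.proj monomial, ← AlgHom.coe_toLinearMap, Submodule.span_image] at hmem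
    obtain ⟨y, hy, hyw⟩ := hmem
    have hy0 : y = 0 := eq_zero_of_residue_eq_zero hy fun s hs => by
      have hS := hs.isTruncatedFlag
      rw [𝒜.residue_eq_of_proj_eq hS.strictMono.monotone (fun p => (hS.isFlat p).1) hyw,
        residue_ιMulti, h _ hS]
    rw [← AlgHom.toLinearMap_apply, ← hyw, hy0, map_zero]

/-! ### Isotropic subspaces -/

theorem flagMap_row {k r : ℕ} (S : Fin k → Submodule ℂ (Fin (n + 1) → ℂ))
    (M : Matrix (Fin r) (Fin l) ℂ) (j : Fin r) (p : Fin k) :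
    𝒜.flagMap S (M.row j) p = 𝒜.decoration M (S p) j := by
  simp [flagMap_apply, decoration]

theorem finrank_map_flagMap {k r : ℕ} (S : Fin k → Submodule ℂ (Fin (n + 1) → ℂ))
    (M : Matrix (Fin r) (Fin l) ℂ) :
    finrank ℂ ((Submodule.span ℂ (Set.range M.row)).map (𝒜.flagMap S)) =
      finrank ℂ (Submodule.span ℂ (Set.range fun p => 𝒜.decoration M (S p))) := by
  set B : Matrix (Fin k) (Fin r) ℂ := Matrix.of fun p => 𝒜.decoration M (S p)
  have h₁ := B.rank_eq_finrank_span_row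
  rw [B.rank_eq_finrank_span_cols] at h₁
  have h : 𝒜.flagMap S ∘ M.row = B.col := funext fun j => funext fun p => 𝒜.flagMap_row S M j p
  rw [← Submodule.span_image, ← Set.range_comp, h]
  exact h₁

theorem det_flagMap_eq_zero_iff {k r : ℕ} (S : Fin k → Submodule ℂ (Fin (n + 1) → ℂ))
    (M : Matrix (Fin r) (Fin l) ℂ) :
    (∀ w : Fin k → Fin l → ℂ, (∀ j, w j ∈ Submodule.span ℂ (Set.range M.row)) →
        Matrix.det (Matrix.of fun j => 𝒜.flagMap S (w j)) = 0) ↔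
      finrank ℂ (Submodule.span ℂ (Set.range fun p => 𝒜.decoration M (S p))) < k := by
  rw [← finrank_map_flagMap]
  set R := Submodule.span ℂ (Set.range M.row)
  have hle := Submodule.finrank_le (R.map (𝒜.flagMap S))
  simp only [finrank_fintype_fun_eq_card, Fintype.card_fin] at hle
  constructor
  · intro h
    refine lt_of_le_of_ne hle fun heq => ?_
    have htop : R.map (𝒜.flagMap S) = ⊤ := Submodule.eq_top_of_finrank_eq (by simpa using heq)
    -- Preimages of the standard basis would give the identity matrix, of determinant 1.
    have : ∀ j : Fin k, ∃ w ∈ R, 𝒜.flagMap S w = Pi.single j 1 := fun j => by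
      have : (Pi.single j 1 : Fin k → ℂ) ∈ R.map (𝒜.flagMap S) := htop ▸ Submodule.mem_top
      simpa using this
    choose w hw hw' using this
    have := h w hw
    have h1 : (Matrix.of fun j => 𝒜.flagMap S (w j)) = 1 := by
      ext i j
      simp [hw', Matrix.one_apply, Pi.single_apply, eq_comm]
    rw [h1, Matrix.det_one] at this
    exact one_ne_zero this
  · intro h w hw
    by_contra hdet
    have hli := Matrix.linearIndependent_rows_of_det_ne_zero hdet
    refine not_le.2 h ?_
    have := finrank_span_eq_card hli
    rw [Fintype.card_fin] at this
    refine this.symm.le.trans ?_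
    refine Submodule.finrank_mono (Submodule.span_le.2 ?_)
    rintro _ ⟨j, rfl⟩
    exact ⟨w j, hw j, rfl⟩

theorem isIsotropic_iff_forall_ιMulti {k : ℕ} {V : Submodule ℂ 𝒜.OS}
    {R : Submodule ℂ (Fin l → ℂ)} (hV : R.map (𝒜.proj.toLinearMap ∘ₗ ι ℂ) = V) :
    𝒜.IsIsotropic k V ↔
      ∀ w : Fin k → Fin l → ℂ, (∀ j, w j ∈ R) → 𝒜.proj (ιMulti ℂ k w) = 0 := by
  subst hV
  constructor
  · intro h w hw
    rw [proj_ιMulti]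
    exact h _ fun j => ⟨w j, hw j, rfl⟩
  · intro h w hw
    choose u hu huw using hw
    rw [← h u hu, proj_ιMulti]
    exact congrArg (fun f => (List.ofFn f).prod) (funext fun j => (huw j).symm)

end ProjArrangement

theorem mainTheorem2 {n l : ℕ} (𝒜 : ProjArrangement n l)
    (V : Submodule ℂ 𝒜.OS) (hV : V ≤ 𝒜.degreeOne)
    {r : ℕ} (M : Matrix (Fin r) (Fin l) ℂ)
    (hM : Submodule.span ℂ (Set.range fun j : Fin r => ∑ i, M j i • 𝒜.gen i) = V)
    (k : ℕ) :
    𝒜.IsIsotropic k V ↔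
      ∀ S : Fin k → Submodule ℂ (Fin (n + 1) → ℂ), 𝒜.IsTruncatedFlag S →
        Module.finrank ℂ
          (Submodule.span ℂ (Set.range fun i : Fin k => 𝒜.decoration M (S i))) < k := by
  have hR : (Submodule.span ℂ (Set.range M.row)).map
      (𝒜.proj.toLinearMap ∘ₗ ExteriorAlgebra.ι ℂ) = V := by
    rw [← hM, ← Submodule.span_image, ← Set.range_comp]
    congr 2
    ext j
    exact 𝒜.proj_ι (M.row j)
  simp only [𝒜.isIsotropic_iff_forall_ιMulti hR, 𝒜.proj_ιMulti_eq_zero_iff,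
    ← 𝒜.det_flagMap_eq_zero_iff]
  exact ⟨fun h S hS w hw => h w hw S hS, fun h w hw S hS => h S hS w hw⟩
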